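/- A pseudo-BCK algebra is a structure $(A,\le,\to,\rightsquigarrow,1)$ with a binary relation $\le$, binary operations $\to,\rightsquigarrow$ and an element $1$ such that for all $x,y,z\in A$: $x\to y\le (y\to z)\rightsquigarrow(x\to z)$ and $x\rightsquigarrow y\le (y\rightsquigarrow z)\to(x\rightsquigarrow z)$; $x\le (x\to y)\rightsquigarrow y$ and $x\le (x\rightsquigarrow y)\to y$; $x\le x$; $x\le 1$; $x\le y$ and $y\le x$ imply $x=y$; and $x\le y$ iff $x\to y=1$ iff $x\rightsquigarrow y=1$. It is bounded if it has an element $0$ with $0\le x$ for all $x\in A$. Let $A$ be a bounded pseudo-BCK algebra. - A state-measure on $A$ is a function $m:A\to[0,\infty)$ with $m(0)=1$ and $m(x\to y)=m(x\rightsquigarrow y)=m(y)-m(x)$ whenever $y\le x$. - A state-measure-morphism on $A$ is a function $m:A\to[0,\infty)$ with $m(0)=1$ and $m(x\to y)=m(x\rightsquigarrow y)=\max\{0,m(y)-m(x)\}$ for all $x,y\in A$. - A Bosbach state on $A$ is a function $s:A\to[0,1]$ with $s(0)=0$, $s(1)=1$, $s(x)+s(x\to y)=s(y)+s(y\to x)$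 and $s(x)+s(x\rightsquigarrow y)=s(y)+s(y\rightsquigarrow x)$ for all $x,y\in A$. - A state-morphism on $A$ is a function $s:A\to[0,1]$ with $s(0)=0$ and $s(x\to y)=s(x\rightsquigarrow y)=\min\{1-s(x)+s(y),1\}$ for all $x,y\in A$. Let $\mathcal{SM}_1(A)$ and $\mathcal{BS}(A)$ be the (possibly empty) sets of state-measures and of Bosbach states on $A$, each with the topology of pointwise convergence. A state-measure $m$ is extremal if $m=\lambda m_1+(1-\lambda)m_2$ with $0<\lambda<1$ and $m_1,m_2\in\mathcal{SM}_1(A)$ implies $m_1=m_2$. **Theorem.** The sets $\mathcal{SM}_1(A)$ and $\mathcal{BS}(A)$ are convex, every state-measure-morphism is a state-measure, and every state-morphism is a Bosbach state. The map $\Psi(m)=1-m$ is a homeomorphism from $\mathcal{SM}_1(A)$ onto $\mathcal{BS}(A)$ that preserves convex combinations, and a state-measure $m$ is a state-measure-morphism if and only if $\Psi(m)$ is a state-morphism. Moreover, a function $m:A\to\mathbb{R}$ is an extremal state-measure if and only if it is a state-measure-morphism. -/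

import Mathlib

/-- A pseudo-BCK algebra `(A, ≤, →, ⇝, 1)`; `arr x y` is `x → y` and `sqarr x y` is `x ⇝ y`.
Transitivity of `≤` is not an axiom (it follows from the others). -/
class PseudoBCKAlgebra (A : Type*) extends LE A, One A where
  arr : A → A → A
  sqarr : A → A → A
  arr_le : ∀ x y z : A, arr x y ≤ sqarr (arr y z) (arr x z)
  sqarr_le : ∀ x y z : A, sqarr x y ≤ arr (sqarr y z) (sqarr x z)
  le_sqarr_arr : ∀ x y : A, x ≤ sqarr (arr x y) y
  le_arr_sqarr : ∀ x y : A, x ≤ arr (sqarr x y) y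
  le_refl : ∀ x : A, x ≤ x
  le_one : ∀ x : A, x ≤ 1
  le_antisymm : ∀ x y : A, x ≤ y → y ≤ x → x = y
  le_iff_arr : ∀ x y : A, x ≤ y ↔ arr x y = 1
  le_iff_sqarr : ∀ x y : A, x ≤ y ↔ sqarr x y = 1

/-- A bounded pseudo-BCK algebra: one with a least element `0`. -/
class BoundedPseudoBCKAlgebra (A : Type*) extends PseudoBCKAlgebra A, Zero A where
  zero_le : ∀ x : A, 0 ≤ x

namespace PseudoBCK

open PseudoBCKAlgebra

/-- A measure on a pseudo-BCK algebra, a function `m : A → [0, ∞)`. -/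
structure IsMeasure {A : Type*} [PseudoBCKAlgebra A] (m : A → ℝ) : Prop where
  nonneg : ∀ x, 0 ≤ m x
  arr_eq : ∀ x y : A, y ≤ x → m (arr x y) = m y - m x
  sqarr_eq : ∀ x y : A, y ≤ x → m (sqarr x y) = m y - m x

/-- A measure-morphism on a pseudo-BCK algebra, a function `m : A → [0, ∞)`. -/
structure IsMeasureMorphism {A : Type*} [PseudoBCKAlgebra A] (m : A → ℝ) : Prop where
  nonneg : ∀ x, 0 ≤ m x
  arr_eq : ∀ x y : A, m (arr x y) = max 0 (m y - m x)
  sqarr_eq : ∀ x y : A, m (sqarr x y) = max 0 (m y - m x)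

/-- A Bosbach state on a bounded pseudo-BCK algebra, a function `s : A → [0, 1]`. -/
structure IsBosbachState {A : Type*} [BoundedPseudoBCKAlgebra A] (s : A → ℝ) : Prop where
  mem_Icc : ∀ x, s x ∈ Set.Icc (0 : ℝ) 1
  arr_eq : ∀ x y : A, s x + s (arr x y) = s y + s (arr y x)
  sqarr_eq : ∀ x y : A, s x + s (sqarr x y) = s y + s (sqarr y x)
  map_zero : s 0 = 0
  map_one : s 1 = 1

/-- The Łukasiewicz implication on the reals of `[0, 1]`. -/
noncomputable def lukImp (a b : ℝ) : ℝ := min (1 - a + b) 1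

/-- A state-morphism on a bounded pseudo-BCK algebra, a function `s : A → [0, 1]`. -/
structure IsStateMorphism {A : Type*} [BoundedPseudoBCKAlgebra A] (s : A → ℝ) : Prop where
  mem_Icc : ∀ x, s x ∈ Set.Icc (0 : ℝ) 1
  map_zero : s 0 = 0
  arr_eq : ∀ x y : A, s (arr x y) = lukImp (s x) (s y)
  sqarr_eq : ∀ x y : A, s (sqarr x y) = lukImp (s x) (s y)

/-- The set of state-measures. As a subtype of `A → ℝ` it carries the topology of pointwise
convergence, which is the weak topology. -/
def stateMeasures (A : Type*) [BoundedPseudoBCKAlgebra A] : Set (A → ℝ) :=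
  {m | IsMeasure m ∧ m 0 = 1}

/-- The set of state-measure-morphisms. -/
def stateMeasureMorphisms (A : Type*) [BoundedPseudoBCKAlgebra A] : Set (A → ℝ) :=
  {m | IsMeasureMorphism m ∧ m 0 = 1}

/-- The set of Bosbach states. As a subtype of `A → ℝ` it carries the topology of pointwise
convergence, which is the weak topology. -/
def bosbachStates (A : Type*) [BoundedPseudoBCKAlgebra A] : Set (A → ℝ) :=
  {s | IsBosbachState s}

/-- The set of state-morphisms. -/
def stateMorphisms (A : Type*) [BoundedPseudoBCKAlgebra A] : Set (A → ℝ) :=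
  {s | IsStateMorphism s}

/-- The set of extremal state-measures: those that lie in no open segment between two distinct
state-measures. -/
def extremalStateMeasures (A : Type*) [BoundedPseudoBCKAlgebra A] : Set (A → ℝ) :=
  Set.extremePoints ℝ (stateMeasures A)

end PseudoBCK

/-!
Let `m` be a state-measure and write `x ∨ y` for `(x → y) ⇝ y`.  This is an upper bound of `x` and
`y`, and it has the largest measure among all upper bounds, so `m (x ∨ y)` is symmetric in `x` and
`y`.  Since `m (x → y) = m y - m (x ∨ y)`, the Bosbach identity for `1 - m` follows, and so does
`m (x → y) = m (x ⇝ y)` for arbitrary `x` and `y`.  This makes `m ↦ 1 - m` a bijection between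
state-measures and Bosbach states.

*Morphisms are extremal.*  Let `m` be a state-measure-morphism and let `m₁` occur in a convex
decomposition of `m`, so that `m₁` vanishes wherever `m` does.  Then `m x ≤ m y` implies
`m₁ (x → y) = m₁ y - m₁ x`.  Given `x`, one of the elements `(x → 0) → x` and `x → (x → 0)`
therefore doubles the difference `m₁ - m` up to sign.  The difference is bounded, so it vanishes
(`IsMeasureMorphism.eq_of_vanish`).

*Extremal state-measures are morphisms.*  For fixed `a` the function
`r x = inf_n m (a → (a → ⋯ → x))` is again a measure, and so is `m - r` (`isMeasure_residual`).
In the language of lattice-ordered groups, `m - r` is the part of `m` carried by the ideal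
generated by `a`.  Extremality forces `r` to be a multiple of `m` (`eq_smul_of_extremal`), and
`r a = 0`, so either `m a = 0` or `r = 0`.  The elements `a = x → y` and `b = y → x` are disjoint
up to `m`: every common upper bound of the two has measure zero (`map_eq_zero_of_prelinear`, where
the element `0` is essential).  Hence `r b = m b`, and one of `m (x → y)`, `m (y → x)` is zero,
which is the morphism property.  All of this takes place in `A` itself: no quotient is formed, and
the failure of commutativity is absorbed by the exchange law `x → (y ⇝ z) = y ⇝ (x → z)` together
with `m (x → y) = m (x ⇝ y)`.
-/

namespace PseudoBCK

open PseudoBCKAlgebra Filter Topology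

local infixr:60 " ⇾ " => PseudoBCKAlgebra.arr
local infixr:60 " ⇝ " => PseudoBCKAlgebra.sqarr

/-! ### Arithmetic of pseudo-BCK algebras -/

section Arithmetic

variable {A : Type*}

/-- The pseudo-BCK algebra with the two implications exchanged. It is not an instance; it serves to
transfer a lemma about one implication to the other. -/
abbrev swap (I : PseudoBCKAlgebra A) : PseudoBCKAlgebra A where
  le := I.le
  one := I.one
  arr := I.sqarr
  sqarr := I.arr
  arr_le := I.sqarr_le
  sqarr_le := I.arr_le
  le_sqarr_arr := I.le_arr_sqarr
  le_arr_sqarr := I.le_sqarr_arr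
  le_refl := I.le_refl
  le_one := I.le_one
  le_antisymm := I.le_antisymm
  le_iff_arr := I.le_iff_sqarr
  le_iff_sqarr := I.le_iff_arr

variable [I : PseudoBCKAlgebra A] {x y z : A}

theorem eq_one_of_one_le (h : 1 ≤ x) : x = 1 :=
  le_antisymm _ _ (le_one x) h

theorem arr_le_arr_right (h : x ≤ y) (z : A) : y ⇾ z ≤ x ⇾ z := by
  have h1 := arr_le x y z
  rw [(le_iff_arr x y).1 h] at h1
  exact (le_iff_sqarr _ _).2 (eq_one_of_one_le h1)

theorem sqarr_le_sqarr_right (h : x ≤ y) (z : A) : y ⇝ z ≤ x ⇝ z :=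
  @arr_le_arr_right A (swap I) x y h z

theorem le_trans' (hxy : x ≤ y) (hyz : y ≤ z) : x ≤ z := by
  have h1 := arr_le_arr_right hxy z
  rw [(le_iff_arr y z).1 hyz] at h1
  exact (le_iff_arr x z).2 (eq_one_of_one_le h1)

theorem le_arr_of_le_sqarr (h : x ≤ y ⇝ z) : y ≤ x ⇾ z :=
  le_trans' (le_arr_sqarr y z) (arr_le_arr_right h z)

theorem arr_le_arr_arr (x y z : A) : y ⇾ z ≤ (x ⇾ y) ⇾ (x ⇾ z) :=
  le_arr_of_le_sqarr (arr_le x y z)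

theorem arr_le_arr_left (z : A) (h : x ≤ y) : z ⇾ x ≤ z ⇾ y := by
  have h1 := arr_le_arr_arr z x y
  rw [(le_iff_arr x y).1 h] at h1
  exact (le_iff_arr _ _).2 (eq_one_of_one_le h1)

theorem arr_sqarr_le (x y z : A) : x ⇾ (y ⇝ z) ≤ y ⇝ (x ⇾ z) :=
  @le_arr_of_le_sqarr A (swap I) _ _ _
    (le_trans' (le_arr_sqarr y z) (arr_le_arr_arr x (y ⇝ z) z))

/-- The exchange law. -/
theorem arr_sqarr_comm (x y z : A) : x ⇾ (y ⇝ z) = y ⇝ (x ⇾ z) :=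
  le_antisymm _ _ (arr_sqarr_le x y z) (@arr_sqarr_le A (swap I) y x z)

theorem arr_self (x : A) : x ⇾ x = 1 :=
  (le_iff_arr x x).1 (le_refl x)

theorem le_arr (x y : A) : y ≤ x ⇾ y := by
  apply le_arr_of_le_sqarr
  rw [(le_iff_sqarr y y).1 (le_refl y)]
  exact le_one x

theorem le_sqarr (x y : A) : y ≤ x ⇝ y :=
  @le_arr A (swap I) x y

theorem arr_sqarr_arr (x y : A) : ((x ⇾ y) ⇝ y) ⇾ y = x ⇾ y :=
  le_antisymm _ _ (arr_le_arr_right (le_sqarr_arr x y) y) (le_arr_sqarr (x ⇾ y) y)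

theorem le_arr_iterate (a x : A) (n : ℕ) : x ≤ (arr a)^[n] x := by
  induction n with
  | zero => exact le_refl x
  | succ n ih =>
    rw [Function.iterate_succ_apply']
    exact le_trans' ih (le_arr _ _)

theorem arr_iterate_mono (a : A) (n : ℕ) (h : x ≤ y) : (arr a)^[n] x ≤ (arr a)^[n] y := by
  induction n with
  | zero => exact h
  | succ n ih =>
    simp only [Function.iterate_succ_apply']
    exact arr_le_arr_left a ih

theorem arr_le_arr_iterate (a x y : A) (n : ℕ) :
    x ⇾ y ≤ (arr a)^[n] x ⇾ (arr a)^[n] y := by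
  induction n with
  | zero => exact le_refl _
  | succ n ih =>
    simp only [Function.iterate_succ_apply']
    exact le_trans' ih (arr_le_arr_arr a _ _)

theorem arr_iterate_sqarr (a x y : A) (n : ℕ) :
    (arr a)^[n] (x ⇝ y) = x ⇝ (arr a)^[n] y := by
  induction n with
  | zero => rfl
  | succ n ih => simp only [Function.iterate_succ_apply', ih, arr_sqarr_comm]

end Arithmetic

/-! ### Measures -/

section Measures

variable {A : Type*} [I : PseudoBCKAlgebra A] {m : A → ℝ} {x y z : A}

theorem IsMeasure.toSwap (hm : IsMeasure m) : @IsMeasure A (swap I) m :=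
  @IsMeasure.mk A (swap I) m hm.nonneg hm.sqarr_eq hm.arr_eq

theorem IsMeasure.map_one (hm : IsMeasure m) : m 1 = 0 := by
  have h := hm.arr_eq 1 1 (le_refl 1)
  rwa [arr_self, sub_self] at h

theorem IsMeasure.antitone (hm : IsMeasure m) (h : x ≤ y) : m y ≤ m x := by
  have h1 := hm.arr_eq y x h
  have h2 := hm.nonneg (y ⇾ x)
  linarith

theorem IsMeasure.map_sup (hm : IsMeasure m) (x y : A) : m ((x ⇾ y) ⇝ y) = m y - m (x ⇾ y) :=
  hm.sqarr_eq _ _ (le_arr x y)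

/-- Among the upper bounds of `x` and `y`, the element `(x → y) ⇝ y` has the largest measure. -/
theorem IsMeasure.map_le_map_sup (hm : IsMeasure m) (hx : x ≤ z) (hy : y ≤ z) :
    m z ≤ m ((x ⇾ y) ⇝ y) := by
  have h1 := hm.antitone (sqarr_le_sqarr_right (arr_le_arr_right hx y) y)
  have h2 := hm.map_sup z y
  have h3 := hm.arr_eq z y hy
  linarith

theorem IsMeasure.map_le_map_sup' (hm : IsMeasure m) (hx : x ≤ z) (hy : y ≤ z) :
    m z ≤ m ((x ⇝ y) ⇾ y) :=
  @IsMeasure.map_le_map_sup A (swap I) m x y z hm.toSwap hx hy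

/-- The identity that makes `1 - m` a Bosbach state. -/
theorem IsMeasure.add_arr_comm (hm : IsMeasure m) (x y : A) :
    m x + m (x ⇾ y) = m y + m (y ⇾ x) := by
  have h1 := hm.map_le_map_sup (le_sqarr _ x) (le_sqarr_arr y x)
  have h2 := hm.map_le_map_sup (le_sqarr _ y) (le_sqarr_arr x y)
  have h3 := hm.map_sup x y
  have h4 := hm.map_sup y x
  linarith

theorem IsMeasure.add_sqarr_comm (hm : IsMeasure m) (x y : A) :
    m x + m (x ⇝ y) = m y + m (y ⇝ x) :=
  @IsMeasure.add_arr_comm A (swap I) m hm.toSwap x y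

/-- A measure does not distinguish the two implications. -/
theorem IsMeasure.map_arr_eq_map_sqarr (hm : IsMeasure m) (x y : A) : m (x ⇾ y) = m (x ⇝ y) := by
  have h1 := hm.map_le_map_sup (le_arr_sqarr x y) (le_arr (x ⇝ y) y)
  have h2 := hm.map_le_map_sup' (le_sqarr_arr x y) (le_sqarr (x ⇾ y) y)
  have h3 := hm.map_sup x y
  have h4 : m ((x ⇝ y) ⇾ y) = m y - m (x ⇝ y) := hm.arr_eq _ _ (le_sqarr x y)
  linarith

theorem IsMeasure.map_le_add_arr (hm : IsMeasure m) (x y : A) : m y ≤ m x + m (x ⇾ y) := by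
  have h1 := hm.add_arr_comm x y
  have h2 := hm.nonneg (y ⇾ x)
  linarith

/-- The triangle inequality. -/
theorem IsMeasure.arr_triangle (hm : IsMeasure m) (x y z : A) :
    m (x ⇾ z) ≤ m (x ⇾ y) + m (y ⇾ z) := by
  have h1 := hm.antitone (arr_le_arr_arr x y z)
  have h2 := hm.map_le_add_arr (x ⇾ y) (x ⇾ z)
  linarith

/-- If `x` lies below `z` up to `m`, and so does `y`, then `z` has at most the measure of
`(x → y) ⇝ y`. -/
theorem IsMeasure.map_le_map_sup_of_arr_eq_zero (hm : IsMeasure m) (hx : m (x ⇾ z) = 0)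
    (hy : m (y ⇾ z) = 0) : m z ≤ m ((x ⇾ y) ⇝ y) := by
  -- Enlarging `z` to `h`, and `h` to an element above `y`, does not change the measure.
  set h := (x ⇾ z) ⇝ z
  have h1 : m h = m z - m (x ⇾ z) := hm.map_sup x z
  have h2 : m ((y ⇾ h) ⇝ h) = m h - m (y ⇾ h) := hm.map_sup y h
  have h3 : m (y ⇾ h) ≤ m (y ⇾ z) := hm.antitone (arr_le_arr_left y (le_sqarr _ z))
  have h4 : m ((y ⇾ h) ⇝ h) ≤ m ((x ⇾ y) ⇝ y) :=
    hm.map_le_map_sup (le_trans' (le_sqarr_arr x z) (le_sqarr _ h)) (le_sqarr_arr y h)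
  linarith

theorem IsMeasure.map_arr_eq_self (hm : IsMeasure m)
    (h : ∀ z, x ≤ z → y ≤ z → m z = 0) : m (x ⇾ y) = m y := by
  have h1 := h _ (le_sqarr_arr x y) (le_sqarr _ y)
  have h2 := hm.map_sup x y
  linarith

theorem IsMeasure.smul (hm : IsMeasure m) {c : ℝ} (hc : 0 ≤ c) : IsMeasure (c • m) where
  nonneg x := mul_nonneg hc (hm.nonneg x)
  arr_eq x y h := by simp [hm.arr_eq x y h, mul_sub]
  sqarr_eq x y h := by simp [hm.sqarr_eq x y h, mul_sub]

theorem IsMeasure.add {m' : A → ℝ} (hm : IsMeasure m) (hm' : IsMeasure m') :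
    IsMeasure (m + m') where
  nonneg x := add_nonneg (hm.nonneg x) (hm'.nonneg x)
  arr_eq x y h := by simp only [Pi.add_apply, hm.arr_eq x y h, hm'.arr_eq x y h]; ring
  sqarr_eq x y h := by simp only [Pi.add_apply, hm.sqarr_eq x y h, hm'.sqarr_eq x y h]; ring

theorem IsMeasure.sub {m' : A → ℝ} (hm : IsMeasure m) (hm' : IsMeasure m')
    (hle : ∀ x, m' x ≤ m x) : IsMeasure (m - m') where
  nonneg x := sub_nonneg.2 (hle x)
  arr_eq x y h := by simp only [Pi.sub_apply, hm.arr_eq x y h, hm'.arr_eq x y h]; ring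
  sqarr_eq x y h := by simp only [Pi.sub_apply, hm.sqarr_eq x y h, hm'.sqarr_eq x y h]; ring

theorem IsMeasureMorphism.isMeasure (hm : IsMeasureMorphism m) : IsMeasure m := by
  have h1 : m 1 = 0 := by
    have h := hm.arr_eq 1 1
    rwa [arr_self, sub_self, max_self] at h
  have anti : ∀ x y : A, y ≤ x → m x ≤ m y := fun x y h => by
    have h2 := hm.arr_eq y x
    rw [(le_iff_arr y x).1 h, h1] at h2
    linarith [le_max_right 0 (m x - m y)]
  exact
    { nonneg := hm.nonneg
      arr_eq := fun x y h => by rw [hm.arr_eq, max_eq_right (sub_nonneg.2 (anti x y h))]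
      sqarr_eq := fun x y h => by rw [hm.sqarr_eq, max_eq_right (sub_nonneg.2 (anti x y h))] }

end Measures

/-! ### The residual of a measure along an element -/

section Residual

variable {A : Type*} [I : PseudoBCKAlgebra A] {m : A → ℝ}

/-- The residual of `m` along `a`: the infimum (in fact the limit) of `m (a → (a → ⋯ → x))` over the
number of arrows. -/
noncomputable def residual (m : A → ℝ) (a x : A) : ℝ := ⨅ n : ℕ, m ((arr a)^[n] x)

theorem IsMeasure.bddBelow_iterate (hm : IsMeasure m) (a x : A) :
    BddBelow (Set.range fun n : ℕ => m ((arr a)^[n] x)) :=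
  ⟨0, by rintro _ ⟨n, rfl⟩; exact hm.nonneg _⟩

theorem IsMeasure.tendsto_residual (hm : IsMeasure m) (a x : A) :
    Tendsto (fun n : ℕ => m ((arr a)^[n] x)) atTop (𝓝 (residual m a x)) := by
  refine tendsto_atTop_ciInf (antitone_nat_of_succ_le fun n => ?_) (hm.bddBelow_iterate a x)
  rw [Function.iterate_succ_apply']
  exact hm.antitone (le_arr _ _)

theorem IsMeasure.residual_nonneg (hm : IsMeasure m) (a x : A) : 0 ≤ residual m a x :=
  le_ciInf fun _ => hm.nonneg _

theorem IsMeasure.residual_le (hm : IsMeasure m) (a x : A) : residual m a x ≤ m x :=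
  ciInf_le (hm.bddBelow_iterate a x) 0

theorem IsMeasure.residual_self (hm : IsMeasure m) (a : A) : residual m a a = 0 := by
  refine _root_.le_antisymm ((ciInf_le (hm.bddBelow_iterate a a) 1).trans_eq ?_)
    (hm.residual_nonneg a a)
  rw [Function.iterate_one, arr_self, hm.map_one]

/-- Arrows of either kind may be exchanged under `m`, because `a → ·` and `a ⇝ ·` commute. -/
theorem IsMeasure.map_arr_iterate (hm : IsMeasure m) (a x : A) (n : ℕ) :
    m ((arr a)^[n] x) = m ((sqarr a)^[n] x) := by
  induction n generalizing x with
  | zero => rfl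
  | succ n ih =>
    rw [Function.iterate_succ_apply', hm.map_arr_eq_map_sqarr, ← arr_iterate_sqarr, ih,
      ← Function.iterate_succ_apply]

theorem IsMeasure.residual_swap (hm : IsMeasure m) (a x : A) :
    residual m a x = @residual A (swap I) m a x :=
  iInf_congr fun n => hm.map_arr_iterate a x n

theorem IsMeasure.residual_sqarr (hm : IsMeasure m) (a : A) {x y : A} (h : y ≤ x) :
    residual m a (x ⇝ y) = residual m a y - residual m a x := by
  have tx := hm.tendsto_residual a x
  have ty := hm.tendsto_residual a y
  have txy := hm.tendsto_residual a (x ⇝ y)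
  have ty2 : Tendsto (fun n : ℕ => m ((arr a)^[n + n] y)) atTop (𝓝 (residual m a y)) :=
    ty.comp (tendsto_atTop_mono (fun n => Nat.le_add_left n n) tendsto_id)
  refine tendsto_nhds_unique txy
    (tendsto_of_tendsto_of_tendsto_of_le_of_le (ty2.sub tx) (ty.sub tx) (fun n => ?_)
      fun n => ?_)
  · -- In an ordered group (where the order of `A` is reversed and `a → x` is `(x - a)⁺`):
    -- `(y - 2na)⁺ ≤ (x - na)⁺ + (y - x - na)⁺`.
    have h1 := hm.antitone (arr_le_arr_iterate a x ((arr a)^[n] y) n)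
    have h2 := hm.map_le_add_arr ((arr a)^[n] x) ((arr a)^[n] ((arr a)^[n] y))
    rw [hm.map_arr_eq_map_sqarr x, ← arr_iterate_sqarr] at h1
    simp only [Function.iterate_add_apply]
    linarith
  · -- In the same notation: `(y - x - na)⁺ ≤ (y - na)⁺ - (x - na)⁺` if `x ≤ y`.
    have h1 := hm.sqarr_eq _ _ (arr_iterate_mono a n h)
    have h2 := hm.antitone (sqarr_le_sqarr_right (le_arr_iterate a x n) ((arr a)^[n] y))
    rw [← arr_iterate_sqarr] at h2
    linarith

theorem IsMeasure.isMeasure_residual (hm : IsMeasure m) (a : A) : IsMeasure (residual m a) where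
  nonneg := hm.residual_nonneg a
  arr_eq x y h := by
    simp only [hm.residual_swap]
    exact @IsMeasure.residual_sqarr A (swap I) m hm.toSwap a x y h
  sqarr_eq _ _ h := hm.residual_sqarr a h

end Residual

section Bounded

variable {A : Type*} [BoundedPseudoBCKAlgebra A] {m : A → ℝ}

open BoundedPseudoBCKAlgebra

/-! ### Disjointness of `x → y` and `y → x` -/

/-- Prelinearity up to a measure: every upper bound of `x → y` and `y → x` is null. -/
theorem IsMeasure.map_eq_zero_of_prelinear (hm : IsMeasure m) {x y J : A}
    (h₁ : x ⇾ y ≤ J) (h₂ : y ⇾ x ≤ J) : m J = 0 := by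
  -- With `d = x ∨ y`, the element `f` plays the role of the negation of the product of `J` and
  -- `d`. That product lies above `x` and `y`, hence above `d`, up to `m`.
  set d := (x ⇾ y) ⇝ y with hd
  set f := J ⇾ d ⇾ 0
  have key : ∀ w : A, w ≤ d → d ⇾ w ≤ J → m (w ⇾ f ⇝ 0) = 0 := by
    intro w hwd hwJ
    set g := (d ⇾ w) ⇾ d ⇾ 0
    set g' := ((w ⇾ 0) ⇝ d ⇾ 0) ⇾ d ⇾ 0
    have hneg : d ⇾ 0 ≤ w ⇾ 0 := arr_le_arr_right hwd 0
    -- Up to `m`, `f` lies below `g`, then `g'` by contraposition, then the negation of `w`.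
    have e1 : m (g' ⇾ w ⇾ 0) = 0 := by
      have i1 : m (g' ⇾ w ⇾ 0) = m (w ⇾ 0) - m g' := hm.arr_eq _ _ (le_arr_sqarr _ _)
      have i2 : m g' = m (d ⇾ 0) - m ((w ⇾ 0) ⇝ d ⇾ 0) := hm.arr_eq _ _ (le_sqarr _ _)
      have i3 := hm.sqarr_eq _ _ hneg
      linarith
    have e2 : m (((w ⇾ 0) ⇝ d ⇾ 0) ⇾ d ⇾ w) ≤ 0 := by
      rw [← arr_sqarr_comm]
      have i1 := hm.antitone (arr_le_arr_arr d ((w ⇾ 0) ⇝ 0) w)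
      have i2 := hm.arr_eq _ _ (le_sqarr_arr w 0)
      have i3 := hm.map_sup w 0
      have i4 := hm.arr_eq _ _ (zero_le w)
      linarith
    have e3 : m (g ⇾ g') ≤ 0 := by
      rw [hm.map_arr_eq_map_sqarr]
      exact (hm.antitone (arr_le _ _ _)).trans e2
    have e4 := hm.arr_triangle g g' (w ⇾ 0)
    have e5 : m (f ⇾ w ⇾ 0) ≤ m (g ⇾ w ⇾ 0) :=
      hm.antitone (arr_le_arr_right (arr_le_arr_right hwJ _) _)
    rw [arr_sqarr_comm, ← hm.map_arr_eq_map_sqarr]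
    linarith [hm.nonneg (f ⇾ w ⇾ 0)]
  have hdx : d ⇾ x ≤ J := le_trans' (arr_le_arr_right (le_sqarr _ y) x) h₂
  have hdy : d ⇾ y ≤ J := by rw [hd, arr_sqarr_arr]; exact h₁
  have h3 : m (f ⇝ 0) ≤ m d :=
    hm.map_le_map_sup_of_arr_eq_zero (key x (le_sqarr_arr x y) hdx) (key y (le_sqarr _ y) hdy)
  have h4 := hm.sqarr_eq _ _ (zero_le f)
  -- Since `d → 0 ≤ J`, the product of `J` and `d` is not truncated at `0`.
  have h5 : m f = m (d ⇾ 0) - m J :=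
    hm.arr_eq _ _ (le_trans' (arr_le_arr_left d (zero_le x)) hdx)
  have h6 := hm.arr_eq _ _ (zero_le d)
  linarith [hm.nonneg J]

theorem IsMeasure.residual_prelinear (hm : IsMeasure m) (x y : A) :
    residual m (x ⇾ y) (y ⇾ x) = m (y ⇾ x) := by
  have h : ∀ n : ℕ, m ((arr (x ⇾ y))^[n] (y ⇾ x)) = m (y ⇾ x) := by
    intro n
    induction n with
    | zero => rfl
    | succ n ih =>
      rw [Function.iterate_succ_apply', ← ih]
      exact hm.map_arr_eq_self fun z h₁ h₂ =>
        hm.map_eq_zero_of_prelinear h₁ (le_trans' (le_arr_iterate _ _ n) h₂)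
  simp [residual, h]

/-! ### Extremal state-measures -/

theorem convex_stateMeasures : Convex ℝ (stateMeasures A) := by
  rintro m ⟨hm, hm0⟩ m' ⟨hm', hm0'⟩ s t hs ht hst
  exact ⟨(hm.smul hs).add (hm'.smul ht), by simp [hm0, hm0', hst]⟩

theorem IsMeasure.eq_zero (hm : IsMeasure m) (h0 : m 0 = 0) : m = 0 :=
  funext fun x => _root_.le_antisymm ((hm.antitone (zero_le x)).trans_eq h0) (hm.nonneg x)

theorem IsMeasure.normalize_mem (hm : IsMeasure m) (h0 : 0 < m 0) :
    (m 0)⁻¹ • m ∈ stateMeasures A :=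
  ⟨hm.smul (inv_nonneg.2 h0.le), by simp [h0.ne']⟩

/-- A measure dominated by an extremal state-measure is a multiple of it. -/
theorem eq_smul_of_extremal (hm : m ∈ extremalStateMeasures A) {r : A → ℝ} (hr : IsMeasure r)
    (hle : ∀ x, r x ≤ m x) : r = r 0 • m := by
  obtain ⟨⟨hmm, h0⟩, hext⟩ := mem_extremePoints_iff_left.1 hm
  have hs : IsMeasure (m - r) := hmm.sub hr hle
  have hs0 : (m - r) 0 = 1 - r 0 := by simp [h0]
  rcases (hr.nonneg 0).eq_or_lt with hc | hc
  · rw [← hc, zero_smul, hr.eq_zero hc.symm]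
  rcases (hs.nonneg 0).eq_or_lt with hd | hd
  · have h1 := hs.eq_zero hd.symm
    have h2 : r 0 = 1 := by linarith
    rw [h2, one_smul, sub_eq_zero.1 h1]
  · have h1 : (r 0)⁻¹ • r = m := by
      refine hext _ (hr.normalize_mem hc) _ (hs.normalize_mem hd)
        ⟨r 0, (m - r) 0, hc, hd, by rw [hs0]; ring, ?_⟩
      rw [smul_inv_smul₀ hc.ne', smul_inv_smul₀ hd.ne']
      abel
    exact (inv_smul_eq_iff₀ hc.ne').1 h1

theorem isMeasureMorphism_of_extremal (hm : m ∈ extremalStateMeasures A) :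
    IsMeasureMorphism m := by
  have hmm := hm.1.1
  have arr : ∀ x y : A, m (x ⇾ y) = max 0 (m y - m x) := by
    intro x y
    have hr := eq_smul_of_extremal hm (hmm.isMeasure_residual (x ⇾ y)) (hmm.residual_le _)
    have h1 := congrFun hr (x ⇾ y)
    have h2 := congrFun hr (y ⇾ x)
    rw [hmm.residual_self] at h1
    rw [hmm.residual_prelinear] at h2
    simp only [Pi.smul_apply, smul_eq_mul] at h1 h2
    have h3 := hmm.add_arr_comm x y
    have h4 := hmm.nonneg (x ⇾ y)
    have h5 := hmm.nonneg (y ⇾ x)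
    rcases mul_eq_zero.1 h1.symm with hc | hc
    · rw [hc, zero_mul] at h2
      rw [max_eq_right] <;> linarith
    · rw [max_eq_left] <;> linarith
  exact ⟨hmm.nonneg, arr, fun x y => (hmm.map_arr_eq_map_sqarr x y).symm.trans (arr x y)⟩

/-- A state-measure that vanishes wherever a given state-measure-morphism does is equal to it. -/
theorem IsMeasureMorphism.eq_of_vanish (hm : IsMeasureMorphism m) (h0 : m 0 = 1) {m₁ : A → ℝ}
    (hm₁ : IsMeasure m₁) (h0₁ : m₁ 0 = 1) (hv : ∀ x, m x = 0 → m₁ x = 0) : m₁ = m := by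
  have hmm := hm.isMeasure
  have arr₁ : ∀ x y : A, m x ≤ m y → m₁ (x ⇾ y) = m₁ y - m₁ x := by
    intro x y h
    have h1 := hv (y ⇾ x) (by rw [hm.arr_eq, max_eq_left (by linarith)])
    have h2 := hm₁.add_arr_comm x y
    linarith
  have arr : ∀ x y : A, m x ≤ m y → m (x ⇾ y) = m y - m x := fun x y h => by
    rw [hm.arr_eq, max_eq_right (by linarith)]
  -- If `|m₁ - m|` reached `ε` somewhere, it would reach `2ε` elsewhere; it is at most `1`.
  have bound : ∀ (n : ℕ) (x : A), |m₁ x - m x| ≤ (1 / 2) ^ n := by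
    intro n
    induction n with
    | zero =>
      intro x
      have i1 := hmm.nonneg x
      have i2 := hm₁.nonneg x
      have i3 := hmm.antitone (zero_le x)
      have i4 := hm₁.antitone (zero_le x)
      rw [pow_zero, abs_le]
      constructor <;> linarith
    | succ n ih =>
      intro x
      have n1 := hmm.arr_eq _ _ (zero_le x)
      have n2 := hm₁.arr_eq _ _ (zero_le x)
      rw [pow_succ]
      rcases le_total (m (x ⇾ 0)) (m x) with h | h
      · have i := ih ((x ⇾ 0) ⇾ x)
        rw [arr _ _ h, arr₁ _ _ h] at i
        rw [abs_le] at i ⊢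
        constructor <;> linarith [i.1, i.2]
      · have i := ih (x ⇾ x ⇾ 0)
        rw [arr _ _ h, arr₁ _ _ h] at i
        rw [abs_le] at i ⊢
        constructor <;> linarith [i.1, i.2]
  funext x
  have h1 : |m₁ x - m x| ≤ 0 :=
    ge_of_tendsto' (tendsto_pow_atTop_nhds_zero_of_lt_one (by norm_num) (by norm_num))
      fun n => bound n x
  exact sub_eq_zero.1 (abs_nonpos_iff.1 h1)

theorem mem_extremalStateMeasures_iff :
    m ∈ extremalStateMeasures A ↔ m ∈ stateMeasureMorphisms A := by
  refine ⟨fun h => ⟨isMeasureMorphism_of_extremal h, h.1.2⟩, ?_⟩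
  rintro ⟨hm, h0⟩
  refine mem_extremePoints_iff_left.2 ⟨⟨hm.isMeasure, h0⟩, ?_⟩
  rintro m₁ ⟨hm₁, h0₁⟩ m₂ ⟨hm₂, -⟩ ⟨s, t, hs, ht, -, rfl⟩
  refine hm.eq_of_vanish h0 hm₁ h0₁ fun x hx => ?_
  simp only [Pi.add_apply, Pi.smul_apply, smul_eq_mul] at hx
  have h1 := mul_nonneg hs.le (hm₁.nonneg x)
  have h2 := mul_nonneg ht.le (hm₂.nonneg x)
  exact (mul_eq_zero.1 (by linarith : s * m₁ x = 0)).resolve_left hs.ne'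

/-! ### Bosbach states -/

variable {s : A → ℝ}

theorem convex_bosbachStates : Convex ℝ (bosbachStates A) := by
  intro s hs s' hs' a b ha hb hab
  have hs : IsBosbachState s := hs
  have hs' : IsBosbachState s' := hs'
  refine ⟨fun x => convex_Icc (0 : ℝ) 1 (hs.mem_Icc x) (hs'.mem_Icc x) ha hb hab,
    fun x y => ?_, fun x y => ?_, ?_, ?_⟩
  · simp only [Pi.add_apply, Pi.smul_apply, smul_eq_mul]
    linear_combination a * hs.arr_eq x y + b * hs'.arr_eq x y
  · simp only [Pi.add_apply, Pi.smul_apply, smul_eq_mul]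
    linear_combination a * hs.sqarr_eq x y + b * hs'.sqarr_eq x y
  · simp [hs.map_zero, hs'.map_zero]
  · simp [hs.map_one, hs'.map_one, hab]

theorem IsStateMorphism.isBosbachState (hs : IsStateMorphism s) : IsBosbachState s where
  mem_Icc := hs.mem_Icc
  arr_eq x y := by
    rw [hs.arr_eq, hs.arr_eq, lukImp, lukImp]
    rcases le_total (s x) (s y) with h | h
    · rw [min_eq_right (by linarith), min_eq_left (by linarith)]; ring
    · rw [min_eq_left (by linarith), min_eq_right (by linarith)]; ring
  sqarr_eq x y := by
    rw [hs.sqarr_eq, hs.sqarr_eq, lukImp, lukImp]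
    rcases le_total (s x) (s y) with h | h
    · rw [min_eq_right (by linarith), min_eq_left (by linarith)]; ring
    · rw [min_eq_left (by linarith), min_eq_right (by linarith)]; ring
  map_zero := hs.map_zero
  map_one := by
    rw [← arr_self (0 : A), hs.arr_eq, lukImp]
    simp

theorem one_sub_mem_Icc (hm : m ∈ stateMeasures A) (x : A) :
    (1 - m) x ∈ Set.Icc (0 : ℝ) 1 := by
  have h1 := hm.1.nonneg x
  have h2 := hm.1.antitone (zero_le x)
  have h3 := hm.2
  constructor <;> simp only [Pi.sub_apply, Pi.one_apply] <;> linarith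

theorem one_sub_mem_bosbachStates (hm : m ∈ stateMeasures A) : 1 - m ∈ bosbachStates A where
  mem_Icc := one_sub_mem_Icc hm
  arr_eq x y := by
    simp only [Pi.sub_apply, Pi.one_apply]
    linarith [hm.1.add_arr_comm x y]
  sqarr_eq x y := by
    simp only [Pi.sub_apply, Pi.one_apply]
    linarith [hm.1.add_sqarr_comm x y]
  map_zero := by simp [hm.2]
  map_one := by simp [hm.1.map_one]

theorem one_sub_mem_stateMeasures (hs : s ∈ bosbachStates A) : 1 - s ∈ stateMeasures A := by
  have hs : IsBosbachState s := hs
  refine ⟨⟨fun x => sub_nonneg.2 (hs.mem_Icc x).2, fun x y h => ?_, fun x y h => ?_⟩, ?_⟩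
  · have h1 := hs.arr_eq x y
    rw [(le_iff_arr y x).1 h, hs.map_one] at h1
    simp only [Pi.sub_apply, Pi.one_apply]
    linarith
  · have h1 := hs.sqarr_eq x y
    rw [(le_iff_sqarr y x).1 h, hs.map_one] at h1
    simp only [Pi.sub_apply, Pi.one_apply]
    linarith
  · simp [hs.map_zero]

theorem lukImp_one_sub (a b : ℝ) : lukImp (1 - a) (1 - b) = 1 - max 0 (b - a) := by
  rw [lukImp, ← min_sub_sub_left, sub_zero, min_comm]
  congr 1
  ring

theorem mem_stateMeasureMorphisms_iff_one_sub (hm : m ∈ stateMeasures A) :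
    m ∈ stateMeasureMorphisms A ↔ 1 - m ∈ stateMorphisms A := by
  constructor
  · rintro ⟨h, h0⟩
    refine ⟨one_sub_mem_Icc hm, by simp [h0], fun x y => ?_, fun x y => ?_⟩
    · simp only [Pi.sub_apply, Pi.one_apply, lukImp_one_sub, h.arr_eq]
    · simp only [Pi.sub_apply, Pi.one_apply, lukImp_one_sub, h.sqarr_eq]
  · intro h
    have h : IsStateMorphism (1 - m) := h
    refine ⟨⟨hm.1.nonneg, fun x y => ?_, fun x y => ?_⟩, hm.2⟩
    · have h1 := h.arr_eq x y
      simp only [Pi.sub_apply, Pi.one_apply, lukImp_one_sub] at h1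
      linarith
    · have h1 := h.sqarr_eq x y
      simp only [Pi.sub_apply, Pi.one_apply, lukImp_one_sub] at h1
      linarith

/-- The homeomorphism `m ↦ 1 - m` from state-measures to Bosbach states. -/
def oneSubHomeomorph (A : Type*) [BoundedPseudoBCKAlgebra A] :
    stateMeasures A ≃ₜ bosbachStates A where
  toFun m := ⟨1 - m.1, one_sub_mem_bosbachStates m.2⟩
  invFun s := ⟨1 - s.1, one_sub_mem_stateMeasures s.2⟩
  left_inv m := Subtype.ext (sub_sub_cancel 1 m.1)
  right_inv s := Subtype.ext (sub_sub_cancel 1 s.1)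
  continuous_toFun := by fun_prop
  continuous_invFun := by fun_prop

end Bounded

end PseudoBCK

theorem mainTheorem7 {A : Type*} [BoundedPseudoBCKAlgebra A] :
    Convex ℝ (PseudoBCK.stateMeasures A) ∧
    Convex ℝ (PseudoBCK.bosbachStates A) ∧
    PseudoBCK.stateMeasureMorphisms A ⊆ PseudoBCK.stateMeasures A ∧
    PseudoBCK.stateMorphisms A ⊆ PseudoBCK.bosbachStates A ∧
    (∃ Ψ : PseudoBCK.stateMeasures A ≃ₜ PseudoBCK.bosbachStates A,
      (∀ (m : PseudoBCK.stateMeasures A) (x : A), (Ψ m : A → ℝ) x = 1 - (m : A → ℝ) x) ∧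
      (∀ (m m₁ m₂ : PseudoBCK.stateMeasures A) (t : ℝ), 0 ≤ t → t ≤ 1 →
        (m : A → ℝ) = t • (m₁ : A → ℝ) + (1 - t) • (m₂ : A → ℝ) →
        (Ψ m : A → ℝ) = t • (Ψ m₁ : A → ℝ) + (1 - t) • (Ψ m₂ : A → ℝ)) ∧
      (∀ m : PseudoBCK.stateMeasures A,
        (m : A → ℝ) ∈ PseudoBCK.stateMeasureMorphisms A ↔
          (Ψ m : A → ℝ) ∈ PseudoBCK.stateMorphisms A)) ∧
    (∀ m : A → ℝ, m ∈ PseudoBCK.extremalStateMeasures A ↔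
      m ∈ PseudoBCK.stateMeasureMorphisms A) := by
  refine ⟨PseudoBCK.convex_stateMeasures, PseudoBCK.convex_bosbachStates,
    fun m hm => ⟨hm.1.isMeasure, hm.2⟩, fun s hs => hs.isBosbachState,
    ⟨PseudoBCK.oneSubHomeomorph A, fun m x => rfl, ?_, fun m =>
      PseudoBCK.mem_stateMeasureMorphisms_iff_one_sub m.2⟩,
    fun m => PseudoBCK.mem_extremalStateMeasures_iff⟩
  intro m m₁ m₂ t _ _ h
  change 1 - (m : A → ℝ) = t • (1 - (m₁ : A → ℝ)) + (1 - t) • (1 - (m₂ : A → ℝ))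
  rw [h]
  module
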